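/- \textbf{Setting.} Let $(\Omega,\mathcal F,\mathbb P)$ be a probability space and $N\ge 1$ an integer. $L^\infty(\mathbb R^N)$ is the space of (a.s.\ equivalence classes of) essentially bounded $\mathbb R^N$-valued random vectors; (in)equalities and limits of random variables are understood a.s., and vectors in $\mathbb R^N$ are ordered componentwise. For $m\in\mathbb R^N$, $a\in\mathbb R$, write $(a,m_{-i})$ for the vector $m$ with its $i$-th entry replaced by $a$. A \emph{coherent risk measure} is a map $\rho\colon L^\infty(\mathbb R)\to\mathbb R$ with $\rho(0)=0$; $\rho(Y^1)\le\rho(Y^2)$ whenever $Y^1\ge Y^2$; $\rho(Y+c)=\rho(Y)-c$ for $c\in\mathbb R$; $\rho(\alpha Y^1+(1-\alpha)Y^2)\le\alpha\rho(Y^1)+(1-\alpha)\rho(Y^2)$ for $\alpha\in[0,1]$; and $\rho(\alpha Y)=\alpha\rho(Y)$ for $\alpha\ge0$. It is \emph{continuous from above} if $Y^n\downarrow Y$ in $L^\infty(\mathbb R)$ implies $\rho(Y^n)\uparrow\rho(Y)$. Its acceptance set is $\mathcal A=\{Y\in L^\infty(\mathbb R) : \rho(Y)\le0\}$. A set $A\subseteq\mathbb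 R^N$ is a \emph{rectangular upper set} if $A=\emptyset$ or $A=A_1\times\dots\times A_N$ where each $A_i$ is $\mathbb R$ or $[x_i,\infty)$ for some $x_i\in\mathbb R$. A function $\Lambda\colon\mathbb R^N\times\mathbb R^N\to\mathbb R\cup\{-\infty\}$, with $\operatorname{dom}\Lambda=\{(x,m):\Lambda(x,m)>-\infty\}$, is an \emph{aggregation function} if it is increasing and concave, $\operatorname{dom}\Lambda$ is nonempty and closed, $\Lambda$ is continuous relative to $\operatorname{dom}\Lambda$, and all sections $\{x:(x,m)\in\operatorname{dom}\Lambda\}$ ($m\in\mathbb R^N$) and $D(x)=\{m:(x,m)\in\operatorname{dom}\Lambda\}$ ($x\in\mathbb R^N$) are rectangular upper sets. For $X\in L^\infty(\mathbb R^N)$ put $D(X)=\{m\in\mathbb R^N:\mathbb P\{(X,m)\in\operatorname{dom}\Lambda\}=1\}$, and let $L^\infty_\Lambda(\mathbb R^N)=\{X\in L^\infty(\mathbb R^N):D(X)\ne\emptyset\}$. Aggregation functions $\Lambda_1,\dots,\Lambda_N$ form a \emph{decomposition} of the aggregation function $\Lambda$ if $\Lambda=\sum_{i=1}^N\Lambda_i$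 and \begin{itemize} \item (consistent domain) $\operatorname{dom}\Lambda_i=\operatorname{dom}\Lambda$ for every $i$; \item (self-feasible) for every $x\in\mathbb R^N$ with $D(x)\neq\emptyset$ there is $\bar r\in D(x)$ such that $\Lambda_i(x,(\bar r_i,m_{-i}))>0$ for all $m\in D(x)$ and all $i$; \item (self-infeasible) for every $x\in\mathbb R^N$ with $D(x)\ne\emptyset$ there is $\underline r\in D(x)$ such that $-\infty\le\Lambda_i(x,(\underline r_i-\varepsilon,m_{-i}))<0$ for all $m\in D(x)$, all $i$ and all $\varepsilon>0$. \end{itemize} A map $r\colon L^\infty_\Lambda(\mathbb R^N)\to\mathbb R^N$ is an \emph{$(\mathcal A,(\Lambda_i))$-Nash allocation rule} if for every $X\in L^\infty_\Lambda(\mathbb R^N)$ and every $i\in\{1,\dots,N\}$, $$r_i(X)=\inf\{m_i\in\mathbb R : (m_i,r_{-i}(X))\in D(X),\ \Lambda_i(X,(m_i,r_{-i}(X)))\in\mathcal A\}.$$ \textbf{Theorem (Existence).} Let $\rho$ be a coherent risk measure that is continuous from above, let $\mathcal A$ be its acceptance set, let $\Lambda$ be an aggregation function and let $(\Lambda_i)_{i=1}^N$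 be a decomposition of $\Lambda$. Then there exists an $(\mathcal A,(\Lambda_i))$-Nash allocation rule $r\colon L^\infty_\Lambda(\mathbb R^N)\to\mathbb R^N$. -/

import Mathlib

open MeasureTheory Set Filter
open scoped ENNReal Topology

namespace NashAllocation

/-! ### Risk measures on `L^∞` -/

section RiskMeasure

variable {Ω : Type*} [MeasurableSpace Ω] {P : Measure Ω} [IsProbabilityMeasure P]

/-- A (monetary) risk measure `ρ : L^∞(ℝ) → ℝ`: normalized, monotone and translative.
Here `Lp.const ∞ P m` is the constant random variable `m`, and `≤` on `Lp` is the
almost sure order. -/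
structure IsRiskMeasure (ρ : Lp ℝ ∞ P → ℝ) : Prop where
  normalized : ρ 0 = 0
  monotone : ∀ Y₁ Y₂ : Lp ℝ ∞ P, Y₂ ≤ Y₁ → ρ Y₁ ≤ ρ Y₂
  translative : ∀ (Y : Lp ℝ ∞ P) (m : ℝ), ρ (Y + Lp.const ∞ P m) = ρ Y - m

/-- A coherent risk measure: a convex and positively homogeneous risk measure. -/
structure IsCoherent (ρ : Lp ℝ ∞ P → ℝ) : Prop extends IsRiskMeasure ρ where
  convex : ∀ (Y₁ Y₂ : Lp ℝ ∞ P) (α : ℝ), 0 ≤ α → α ≤ 1 →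
    ρ (α • Y₁ + (1 - α) • Y₂) ≤ α * ρ Y₁ + (1 - α) * ρ Y₂
  pos_homogeneous : ∀ (Y : Lp ℝ ∞ P) (α : ℝ), 0 ≤ α → ρ (α • Y) = α * ρ Y

/-- Continuity from above: if `Yₙ ↓ Y` almost surely, then `ρ Yₙ ↑ ρ Y`. -/
def ContinuousFromAbove (ρ : Lp ℝ ∞ P → ℝ) : Prop :=
  ∀ (Ys : ℕ → Lp ℝ ∞ P) (Y : Lp ℝ ∞ P), Antitone Ys →
    (∀ᵐ ω ∂P, Tendsto (fun n => Ys n ω) atTop (𝓝 (Y ω))) →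
    Monotone (fun n => ρ (Ys n)) ∧ Tendsto (fun n => ρ (Ys n)) atTop (𝓝 (ρ Y))

/-- The acceptance set of `ρ`. -/
def acceptanceSet (ρ : Lp ℝ ∞ P → ℝ) : Set (Lp ℝ ∞ P) := {Y | ρ Y ≤ 0}

end RiskMeasure

/-! ### Aggregation functions -/

section Aggregation

variable {N : ℕ}

/-- Rectangular upper sets of `ℝ^N`: the empty set, and products of sets each of which is
`ℝ` or a half-line `[a, ∞)`. -/
def IsRectangularUpper (A : Set (Fin N → ℝ)) : Prop :=
  A = ∅ ∨ ∃ B : Fin N → Set ℝ, (∀ i, B i = univ ∨ ∃ a : ℝ, B i = Ici a) ∧ A = univ.pi B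

/-- The effective domain of an extended-real function on `ℝ^N × ℝ^N`. -/
def effDom (Λ : (Fin N → ℝ) × (Fin N → ℝ) → EReal) : Set ((Fin N → ℝ) × (Fin N → ℝ)) :=
  {p | Λ p ≠ ⊥}

/-- The domain `dom Λ|^x = {m | (x, m) ∈ dom Λ}` of the section `m ↦ Λ(x, m)`. -/
def capSection (Λ : (Fin N → ℝ) × (Fin N → ℝ) → EReal) (x : Fin N → ℝ) : Set (Fin N → ℝ) :=
  {m | (x, m) ∈ effDom Λ}

/-- The domain `dom Λ|_m = {x | (x, m) ∈ dom Λ}` of the section `x ↦ Λ(x, m)`. -/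
def shockSection (Λ : (Fin N → ℝ) × (Fin N → ℝ) → EReal) (m : Fin N → ℝ) : Set (Fin N → ℝ) :=
  {x | (x, m) ∈ effDom Λ}

/-- Aggregation functions `Λ : ℝ^N × ℝ^N → ℝ ∪ {-∞}`. An extended-real function without the
value `+∞` is concave exactly when its effective domain is convex and it is concave
there as a real-valued function; this is what `concave` says. -/
structure IsAggregation (Λ : (Fin N → ℝ) × (Fin N → ℝ) → EReal) : Prop where
  ne_top : ∀ p, Λ p ≠ ⊤
  monotone : Monotone Λ
  concave : ConcaveOn ℝ (effDom Λ) (fun p => (Λ p).toReal)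
  dom_nonempty : (effDom Λ).Nonempty
  dom_closed : IsClosed (effDom Λ)
  continuousOn : ContinuousOn Λ (effDom Λ)
  rect_shock : ∀ m, IsRectangularUpper (shockSection Λ m)
  rect_cap : ∀ x, IsRectangularUpper (capSection Λ x)

/-- `(Λᵢ)` is a decomposition of `Λ`. The vector `(a, m_{-i})` is `Function.update m i a`. -/
structure IsDecomposition (Λ : (Fin N → ℝ) × (Fin N → ℝ) → EReal)
    (Λs : Fin N → (Fin N → ℝ) × (Fin N → ℝ) → EReal) : Prop where
  aggregation : ∀ i, IsAggregation (Λs i)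
  sum_eq : ∀ p, Λ p = ∑ i, Λs i p
  consistent_domain : ∀ i, effDom (Λs i) = effDom Λ
  self_feasible : ∀ x, (capSection Λ x).Nonempty →
    ∃ rU ∈ capSection Λ x, ∀ m ∈ capSection Λ x, ∀ i,
      0 < Λs i (x, Function.update m i (rU i))
  self_infeasible : ∀ x, (capSection Λ x).Nonempty →
    ∃ rL ∈ capSection Λ x, ∀ m ∈ capSection Λ x, ∀ i, ∀ ε : ℝ, 0 < ε →
      Λs i (x, Function.update m i (rL i - ε)) < 0

end Aggregation

/-! ### Nash allocation rules -/

section Nash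

variable {Ω : Type*} [MeasurableSpace Ω] {P : Measure Ω} [IsProbabilityMeasure P] {N : ℕ}

/-- `D(X) = {m | (X, m) ∈ dom Λ almost surely}` for an essentially bounded random vector `X`. -/
def capDomain (Λ : (Fin N → ℝ) × (Fin N → ℝ) → EReal) (X : Lp (Fin N → ℝ) ∞ P) :
    Set (Fin N → ℝ) :=
  {m | ∀ᵐ ω ∂P, (X ω, m) ∈ effDom Λ}

/-- `L^∞_Λ(ℝ^N)`: the essentially bounded random vectors `X` with `D(X) ≠ ∅`. -/
def shockSpace (P : Measure Ω) (Λ : (Fin N → ℝ) × (Fin N → ℝ) → EReal) :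
    Set (Lp (Fin N → ℝ) ∞ P) :=
  {X | (capDomain Λ X).Nonempty}

/-- `F(X, m) ∈ 𝒜`: the random variable `F(X, m)` is (almost surely equal to) an element of
`L^∞(ℝ)` that lies in `𝒜`. In particular it is almost surely finite. -/
def Accepts (𝒜 : Set (Lp ℝ ∞ P)) (F : (Fin N → ℝ) × (Fin N → ℝ) → EReal)
    (X : Lp (Fin N → ℝ) ∞ P) (m : Fin N → ℝ) : Prop :=
  ∃ Y ∈ 𝒜, ∀ᵐ ω ∂P, F (X ω, m) = ((Y ω : ℝ) : EReal)

/-- `r : L^∞_Λ(ℝ^N) → ℝ^N` is an `(𝒜, (Λᵢ))`-Nash allocation rule: for all `X` and `i`, the real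
number `rᵢ(X)` is the infimum of the set of the `a ∈ ℝ` with `(a, r_{-i}(X)) ∈ D(X)` and
`Λᵢ(X, (a, r_{-i}(X))) ∈ 𝒜`. -/
def IsNashAllocationRule (𝒜 : Set (Lp ℝ ∞ P)) (Λ : (Fin N → ℝ) × (Fin N → ℝ) → EReal)
    (Λs : Fin N → (Fin N → ℝ) × (Fin N → ℝ) → EReal)
    (r : shockSpace P Λ → Fin N → ℝ) : Prop :=
  ∀ (X : shockSpace P Λ) (i : Fin N),
    IsGLB {a : ℝ | Function.update (r X) i a ∈ capDomain Λ X.1 ∧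
      Accepts 𝒜 (Λs i) X.1 (Function.update (r X) i a)} (r X i)

end Nash

end NashAllocation

open NashAllocation

/-!
Fix a shock `X`. Since the sections of `dom Λ` in the shock variable are rectangular upper sets, the
set `D(X)` of capital vectors equals `D(x₀)`, where `x₀` is the componentwise essential infimum of
`X` (`exists_essential_bounds`, `IsAggregation.capDomain_eq_capSection`). Let `x₁` be an essential
upper bound of `X`. Self-feasibility at `x₀` gives an upper bound for what each institution needs,
whatever the others hold, and self-infeasibility at `x₁` a lower bound. A Nash allocation is
therefore to be found in a compact box inside `D(X)`.

On this box the risk `φ i m = ρ (Λᵢ(X, m))` is continuous, because `Λᵢ` is uniformly continuous on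
the product of `[x₀, x₁]` with the box and `ρ` is `1`-Lipschitz
(`IsAggregation.continuousOn_risk_aggregate`); it is also convex
(`IsAggregation.convexOn_risk_aggregate`). The map that replaces each `m i` by `m i + φ i m`,
clamped to the box, has a fixed point `r`. At `r` the risk `φ i r` is nonpositive, and it is zero unless
`r i` is the lower end of its interval. If it is zero, then convexity and `φ i < 0` at the upper end make
`φ i` positive for every smaller `i`-th coordinate. So `r i` is the least amount that is acceptable
for `i` given the others (`exists_isLeast_of_convexOn`).

Brouwer's theorem on a box (`exists_fixedPoint_Icc`) follows from the one on the simplex, and this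
one from Scarf's lemma on dominant sets of points ranked by several linear orders
(`exists_isDominant_image_eq_univ`), a parity argument in the manner of Sperner. Applied to grid
points ranked by their coordinates, where `x` gets a colour `i` with `x i ≤ f x i`, it yields small
clusters of grid points. In the limit these give a point `x` with `x i ≤ f x i` for all `i`, hence a
fixed point.
-/

namespace NashAllocation

/-! ### Scarf's combinatorial lemma -/

section Scarf

variable {I V α : Type*} [LinearOrder α]

/-- A set `S` is dominant with respect to the rankings `u i` if no `y` is strictly above some
element of `S` in every ranking. -/
def IsDominant (u : I → V → α) (S : Finset V) : Prop :=
  ∀ y, ∃ i, ∀ x ∈ S, u i y ≤ u i x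

lemma IsDominant.mono {u : I → V → α} {S T : Finset V} (hT : IsDominant u T) (hST : S ⊆ T) :
    IsDominant u S := fun y =>
  let ⟨i, hi⟩ := hT y
  ⟨i, fun x hx => hi x (hST hx)⟩

/-- The elements `y` that lie, in every ranking except the `j`-th, above the marked element `p i`.
When `p i` is the `i`-minimum of a dominant set of `card I - 1` elements, the elements that extend
this set to a dominant one are the `j`-maximal members of these sets. -/
def candidates [Fintype I] [DecidableEq I] [Fintype V] (u : I → V → α) (p : I → V)
    (j : I) : Finset V :=
  {y | ∀ i, i ≠ j → u i (p i) < u i y}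

lemma disjoint_candidates [Fintype I] [DecidableEq I] [Fintype V] {u : I → V → α} {S : Finset V}
    {p : I → V} (hS : IsDominant u S) (hpS : ∀ i, p i ∈ S) {j k : I} (hjk : j ≠ k)
    {x : V} (hj : x ∈ candidates u p j) : x ∉ candidates u p k := by
  intro hk
  simp only [candidates, Finset.mem_filter, Finset.mem_univ, true_and] at hj hk
  obtain ⟨i, hi⟩ := hS x
  by_cases hij : i = j
  · exact absurd (hi _ (hpS i)) (not_le.2 (hk i (hij ▸ hjk)))
  · exact absurd (hi _ (hpS i)) (not_le.2 (hj i hij))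

variable [Fintype I] [DecidableEq I] [DecidableEq V]

/-- A map from `I` onto a set with one element fewer identifies exactly one pair of indices, and
the two members of that pair are the only indices that can be dropped. -/
lemma exists_pair_of_image_eq {p : I → V} {S : Finset V} (hp : Finset.univ.image p = S)
    (hcard : S.card + 1 = Fintype.card I) :
    ∃ j₁ j₂, j₁ ≠ j₂ ∧ (Finset.univ.erase j₁).image p = S ∧ (Finset.univ.erase j₂).image p = S ∧
      ∀ j, (Finset.univ.erase j).image p = S → j = j₁ ∨ j = j₂ := by
  have hninj : ¬ Function.Injective p := by
    intro h
    have := Finset.card_image_of_injective Finset.univ h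
    rw [hp, Finset.card_univ] at this
    omega
  simp only [Function.Injective, not_forall] at hninj
  obtain ⟨j₁, j₂, hpj, hne⟩ := hninj
  have key : ∀ a b : I, a ≠ b → p a = p b → (Finset.univ.erase a).image p = S := by
    intro a b hab h
    rw [← hp]
    ext v
    simp only [Finset.mem_image, Finset.mem_erase, Finset.mem_univ, and_true, true_and]
    constructor
    · rintro ⟨k, -, rfl⟩
      exact ⟨k, rfl⟩
    · rintro ⟨k, rfl⟩
      by_cases hk : k = a
      · exact ⟨b, hab.symm, by rw [hk, h]⟩
      · exact ⟨k, hk, rfl⟩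
  have h₁ := key j₁ j₂ hne hpj
  refine ⟨j₁, j₂, hne, h₁, key j₂ j₁ (Ne.symm hne) hpj.symm, fun j hj => ?_⟩
  have hinj : Set.InjOn p (Finset.univ.erase j₁ : Finset I) := by
    apply Finset.injOn_of_card_image_eq
    rw [h₁, Finset.card_erase_of_mem (Finset.mem_univ _), Finset.card_univ]
    omega
  have hjS : p j ∈ (Finset.univ.erase j).image p := by
    rw [hj, ← hp]
    exact Finset.mem_image_of_mem _ (Finset.mem_univ _)
  obtain ⟨k, hk, hkj⟩ := Finset.mem_image.1 hjS
  have hkj' : k ≠ j := (Finset.mem_erase.1 hk).1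
  by_contra! hcon
  by_cases hk1 : k = j₁
  · refine hcon.2 (hinj (by simpa using hcon.1) (by simpa using Ne.symm hne) ?_)
    rw [← hkj, hk1, hpj]
  · exact hkj' (hinj (by simpa using hk1) (by simpa using hcon.1) hkj)

variable [Fintype V] {u : I → V → α} {S : Finset V} {p : I → V}

/-- One direction of the description of the dominant extensions of a dominant set. -/
lemma isDominant_insert_of_candidate (hS : IsDominant u S)
    (hp : ∀ i, ∀ x ∈ S, u i (p i) ≤ u i x) (hpS : ∀ i, p i ∈ S) {j : I}
    (hj : (Finset.univ.erase j).image p = S) {x : V} (hx : x ∈ candidates u p j)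
    (hmax : ∀ y ∈ candidates u p j, u j y ≤ u j x) :
    x ∉ S ∧ IsDominant u (insert x S) := by
  simp only [candidates, Finset.mem_filter, Finset.mem_univ, true_and] at hx hmax
  refine ⟨fun hxS => ?_, fun y => ?_⟩
  · rw [← hj] at hxS
    obtain ⟨k, hk, rfl⟩ := Finset.mem_image.1 hxS
    exact lt_irrefl _ (hx k (Finset.mem_erase.1 hk).1)
  · by_cases hy : ∀ i, i ≠ j → u i (p i) < u i y
    · refine ⟨j, fun z hz => ?_⟩
      rcases Finset.mem_insert.1 hz with rfl | hz
      · exact hmax y hy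
      · obtain ⟨i, hi⟩ := hS x
        have hij : i = j := by
          by_contra hij
          exact absurd (hi _ (hpS i)) (not_le.2 (hx i hij))
        subst hij
        exact (hmax y hy).trans (hi z hz)
    · push Not at hy
      obtain ⟨i, hij, hi⟩ := hy
      refine ⟨i, fun z hz => ?_⟩
      rcases Finset.mem_insert.1 hz with rfl | hz
      · exact hi.trans (hx i hij).le
      · exact hi.trans (hp i z hz)

/-- The converse: every dominant extension by one element comes from a droppable index `j`. -/
lemma exists_candidate_of_isDominant_insert (hu : ∀ i, Function.Injective (u i))
    (hcard : S.card + 1 = Fintype.card I)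
    (hp : ∀ i, ∀ x ∈ S, u i (p i) ≤ u i x) (hpS : ∀ i, p i ∈ S) {x : V} (hxS : x ∉ S)
    (hx : IsDominant u (insert x S)) :
    ∃ j, (Finset.univ.erase j).image p = S ∧ x ∈ candidates u p j ∧
      ∀ y ∈ candidates u p j, u j y ≤ u j x := by
  obtain ⟨j, hj⟩ := hx x
  -- An index for which `x` is minimal is not needed to reach the elements of `S` as minima.
  have hcover : ∀ z ∈ S, ∃ k, p k = z ∧ ∀ i, (∀ w ∈ S, u i x ≤ u i w) → k ≠ i := by
    intro z hz
    obtain ⟨k, hk⟩ := hx z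
    refine ⟨k, hu k (le_antisymm (hp k z hz) (hk _ (Finset.mem_insert_of_mem (hpS k)))), ?_⟩
    rintro i hi rfl
    have : z = x := hu k (le_antisymm (hk x (Finset.mem_insert_self _ _)) (hi z hz))
    exact hxS (this ▸ hz)
  have hjS : ∀ w ∈ S, u j x ≤ u j w := fun w hw => hj w (Finset.mem_insert_of_mem hw)
  have hxc : ∀ i, i ≠ j → u i (p i) < u i x := by
    intro i hij
    by_contra hle
    rw [not_lt] at hle
    have hsub : S ⊆ ((Finset.univ.erase j).erase i).image p := by
      intro z hz
      obtain ⟨k, hk, hk'⟩ := hcover z hz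
      refine Finset.mem_image.2 ⟨k, ?_, hk⟩
      simp only [Finset.mem_erase, Finset.mem_univ, and_true]
      exact ⟨hk' i fun w hw => hle.trans (hp i w hw), hk' j hjS⟩
    have h1 := (Finset.card_le_card hsub).trans Finset.card_image_le
    rw [Finset.card_erase_of_mem (by simpa using hij),
      Finset.card_erase_of_mem (Finset.mem_univ _), Finset.card_univ] at h1
    have h2 : 1 < Fintype.card I := Fintype.one_lt_card_iff.2 ⟨i, j, hij⟩
    omega
  refine ⟨j, ?_, by simpa [candidates] using hxc, fun y hy => ?_⟩
  · apply Finset.Subset.antisymm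
    · intro z hz
      obtain ⟨k, -, rfl⟩ := Finset.mem_image.1 hz
      exact hpS k
    · intro z hz
      obtain ⟨k, hk, hk'⟩ := hcover z hz
      exact Finset.mem_image.2 ⟨k, by simpa using hk' j hjS, hk⟩
  · simp only [candidates, Finset.mem_filter, Finset.mem_univ, true_and] at hy
    obtain ⟨i, hi⟩ := hx y
    have hij : i = j := by
      by_contra hij
      exact absurd (hi _ (Finset.mem_insert_of_mem (hpS i))) (not_le.2 (hy i hij))
    subst hij
    exact hi x (Finset.mem_insert_self _ _)

/-- The dominant sets of `card I` elements that contain a given `S` of `card I - 1` elements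
correspond to the elements that extend `S`. -/
lemma card_filter_superset_eq {R : Finset V → Prop} [DecidablePred R] {X : Finset V}
    {n : ℕ} (hcard : S.card + 1 = n)
    (hX : ∀ x, x ∈ X ↔ x ∉ S ∧ R (insert x S)) :
    (Finset.univ.filter fun T : Finset V => (R T ∧ T.card = n) ∧ S ⊆ T).card = X.card := by
  symm
  apply Finset.card_bij (fun x _ => insert x S)
  · intro x hx
    obtain ⟨h1, h2⟩ := (hX x).1 hx
    simp [h2, Finset.card_insert_of_notMem h1, hcard]
  · intro x hx y hy hxy
    have : x ∈ insert y S := hxy ▸ Finset.mem_insert_self x S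
    exact (Finset.mem_insert.1 this).resolve_right ((hX x).1 hx).1
  · intro T hT
    simp only [Finset.mem_filter, Finset.mem_univ, true_and] at hT
    obtain ⟨⟨hR, hTc⟩, hST⟩ := hT
    have h1 : (T \ S).card = 1 := by
      rw [Finset.card_sdiff_of_subset hST]; omega
    obtain ⟨x, hx⟩ := Finset.card_eq_one.1 h1
    have hxT : insert x S = T := by
      rw [← Finset.sdiff_union_of_subset hST, hx]; rfl
    have hxS : x ∉ S := by
      have : x ∈ T \ S := hx ▸ Finset.mem_singleton_self x
      exact (Finset.mem_sdiff.1 this).2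
    exact ⟨x, (hX x).2 ⟨hxS, hxT ▸ hR⟩, hxT⟩

/-- The pseudomanifold property. In a dominant set `S` of `card I - 1` elements exactly two indices
`j₁`, `j₂` share their minimum `p j₁ = p j₂`. Each of them contributes one dominant extension of `S`
by one element, provided that its candidate set is nonempty. -/
lemma exists_extensions (hu : ∀ i, Function.Injective (u i)) (hS : IsDominant u S)
    (hne : S.Nonempty) (hcard : S.card + 1 = Fintype.card I) :
    ∃ p : I → V, (∀ i, p i ∈ S) ∧ (∀ i, ∀ x ∈ S, u i (p i) ≤ u i x) ∧
      ∃ j₁ j₂, j₁ ≠ j₂ ∧ (∀ j, (Finset.univ.erase j).image p = S → j = j₁ ∨ j = j₂) ∧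
      (Finset.univ.erase j₁).image p = S ∧ (Finset.univ.erase j₂).image p = S ∧
      ((candidates u p j₁).Nonempty → (candidates u p j₂).Nonempty →
        ∃ X : Finset V, X.card = 2 ∧ ∀ x, x ∈ X ↔ x ∉ S ∧ IsDominant u (insert x S)) ∧
      ((candidates u p j₁).Nonempty → ¬ (candidates u p j₂).Nonempty →
        ∃ X : Finset V, X.card = 1 ∧ ∀ x, x ∈ X ↔ x ∉ S ∧ IsDominant u (insert x S)) ∧
      (¬ (candidates u p j₁).Nonempty → (candidates u p j₂).Nonempty →
        ∃ X : Finset V, X.card = 1 ∧ ∀ x, x ∈ X ↔ x ∉ S ∧ IsDominant u (insert x S)) := by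
  choose p hpS hp using fun i => S.exists_min_image (u i) hne
  have himg : Finset.univ.image p = S := by
    apply Finset.Subset.antisymm
    · intro z hz
      obtain ⟨k, -, rfl⟩ := Finset.mem_image.1 hz
      exact hpS k
    · intro z hz
      obtain ⟨i, hi⟩ := hS z
      exact Finset.mem_image.2 ⟨i, Finset.mem_univ _,
        hu i (le_antisymm (hp i z hz) (hi _ (hpS i)))⟩
  obtain ⟨j₁, j₂, hj, h₁, h₂, hall⟩ := exists_pair_of_image_eq himg hcard
  have hiff : ∀ x, (x ∉ S ∧ IsDominant u (insert x S)) ↔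
      (x ∈ candidates u p j₁ ∧ ∀ y ∈ candidates u p j₁, u j₁ y ≤ u j₁ x) ∨
      (x ∈ candidates u p j₂ ∧ ∀ y ∈ candidates u p j₂, u j₂ y ≤ u j₂ x) := by
    intro x
    constructor
    · rintro ⟨hxS, hx⟩
      obtain ⟨j, hj, hc, hm⟩ := exists_candidate_of_isDominant_insert hu hcard hp hpS hxS hx
      rcases hall j hj with rfl | rfl
      · exact Or.inl ⟨hc, hm⟩
      · exact Or.inr ⟨hc, hm⟩
    · rintro (⟨hc, hm⟩ | ⟨hc, hm⟩)
      · exact isDominant_insert_of_candidate hS hp hpS h₁ hc hm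
      · exact isDominant_insert_of_candidate hS hp hpS h₂ hc hm
  have huniq : ∀ j x, x ∈ candidates u p j → (∀ y ∈ candidates u p j, u j y ≤ u j x) →
      ∀ z, (z ∈ candidates u p j ∧ ∀ y ∈ candidates u p j, u j y ≤ u j z) ↔ z = x := by
    intro j x hx hm z
    constructor
    · rintro ⟨hz, hz'⟩
      exact hu j (le_antisymm (hm z hz) (hz' x hx))
    · rintro rfl
      exact ⟨hx, hm⟩
  refine ⟨p, hpS, hp, j₁, j₂, hj, hall, h₁, h₂, fun n₁ n₂ => ?_, fun n₁ n₂ => ?_, fun n₁ n₂ => ?_⟩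
  · obtain ⟨x₁, hx₁, hm₁⟩ := Finset.exists_max_image _ (u j₁) n₁
    obtain ⟨x₂, hx₂, hm₂⟩ := Finset.exists_max_image _ (u j₂) n₂
    have hne : x₁ ≠ x₂ := by
      rintro rfl
      exact disjoint_candidates hS hpS hj hx₁ hx₂
    refine ⟨{x₁, x₂}, Finset.card_pair hne, fun x => ?_⟩
    rw [hiff, huniq j₁ x₁ hx₁ hm₁, huniq j₂ x₂ hx₂ hm₂]
    simp
  · obtain ⟨x₁, hx₁, hm₁⟩ := Finset.exists_max_image _ (u j₁) n₁
    refine ⟨{x₁}, rfl, fun x => ?_⟩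
    rw [hiff, huniq j₁ x₁ hx₁ hm₁, Finset.not_nonempty_iff_eq_empty.1 n₂]
    simp
  · obtain ⟨x₂, hx₂, hm₂⟩ := Finset.exists_max_image _ (u j₂) n₂
    refine ⟨{x₂}, rfl, fun x => ?_⟩
    rw [hiff, huniq j₂ x₂ hx₂ hm₂, Finset.not_nonempty_iff_eq_empty.1 n₁]
    simp

/-- Sperner's parity observation: a set of `card I` elements that misses a colour has zero or two
facets carrying exactly the colours other than `i₀`. -/
lemma even_card_facets {c : V → I} {i₀ : I} {T : Finset V} (hT : T.card = Fintype.card I)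
    (hc : T.image c ≠ Finset.univ) :
    Even (Finset.univ.filter fun S : Finset V =>
      S.card + 1 = Fintype.card I ∧ S.image c = Finset.univ.erase i₀ ∧ S ⊆ T).card := by
  have hcount : (Finset.univ.filter fun S : Finset V =>
      S.card + 1 = Fintype.card I ∧ S.image c = Finset.univ.erase i₀ ∧ S ⊆ T).card =
      (T.filter fun x => (T.erase x).image c = Finset.univ.erase i₀).card := by
    symm
    apply Finset.card_bij (fun x _ => T.erase x)
    · intro x hx
      obtain ⟨h1, h2⟩ := Finset.mem_filter.1 hx
      simp only [Finset.mem_filter, Finset.mem_univ, true_and]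
      exact ⟨by rw [Finset.card_erase_add_one h1, hT], h2, Finset.erase_subset _ _⟩
    · intro x hx y hy hxy
      exact Finset.erase_injOn T (Finset.mem_filter.1 hx).1 (Finset.mem_filter.1 hy).1 hxy
    · intro S hS
      simp only [Finset.mem_filter, Finset.mem_univ, true_and] at hS
      obtain ⟨h1, h2, h3⟩ := hS
      have h4 : (T \ S).card = 1 := by rw [Finset.card_sdiff_of_subset h3]; omega
      obtain ⟨x, hx⟩ := Finset.card_eq_one.1 h4
      have hxT : x ∈ T := (Finset.mem_sdiff.1 (hx ▸ Finset.mem_singleton_self x : x ∈ T \ S)).1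
      have he : T.erase x = S := by
        rw [← Finset.sdiff_singleton_eq_erase, ← hx, Finset.sdiff_sdiff_eq_self h3]
      exact ⟨x, Finset.mem_filter.2 ⟨hxT, he ▸ h2⟩, he⟩
  rw [hcount]
  rcases (T.filter fun x => (T.erase x).image c = Finset.univ.erase i₀).eq_empty_or_nonempty with
    h | ⟨x₀, hx₀⟩
  · simp [h]
  obtain ⟨hx₀T, himg⟩ := Finset.mem_filter.1 hx₀
  have hinj : Set.InjOn c (T.erase x₀ : Finset V) := by
    apply Finset.injOn_of_card_image_eq
    rw [himg, Finset.card_erase_of_mem (Finset.mem_univ _), Finset.card_univ,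
      Finset.card_erase_of_mem hx₀T, hT]
  have hTimg : ∀ x ∈ T, T.image c = insert (c x) ((T.erase x).image c) := by
    intro x hx
    rw [← Finset.image_insert, Finset.insert_erase hx]
  have hc₀ : c x₀ ≠ i₀ := by
    intro h
    apply hc
    rw [hTimg x₀ hx₀T, himg, h, Finset.insert_erase (Finset.mem_univ _)]
  obtain ⟨x₁, hx₁, hc₁⟩ : ∃ x₁ ∈ T.erase x₀, c x₁ = c x₀ := by
    apply Finset.mem_image.1
    rw [himg]
    simpa using hc₀
  obtain ⟨hne, hx₁T⟩ := Finset.mem_erase.1 hx₁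
  have : (T.filter fun x => (T.erase x).image c = Finset.univ.erase i₀) = {x₀, x₁} := by
    ext x
    simp only [Finset.mem_filter, Finset.mem_insert, Finset.mem_singleton]
    constructor
    · rintro ⟨hxT, hx⟩
      by_contra! hcon
      have hx' : x ∈ T.erase x₀ := Finset.mem_erase.2 ⟨hcon.1, hxT⟩
      have : c x ∈ (T.erase x).image c := by
        rw [hx, ← himg]
        exact Finset.mem_image_of_mem _ hx'
      obtain ⟨z, hz, hzx⟩ := Finset.mem_image.1 this
      obtain ⟨hzne, hzT⟩ := Finset.mem_erase.1 hz
      by_cases hz0 : z = x₀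
      · exact hcon.2 (hinj hx' hx₁ (by rw [← hzx, hz0, hc₁]))
      · exact hzne (hinj (Finset.mem_coe.2 (Finset.mem_erase.2 ⟨hz0, hzT⟩)) hx' hzx)
    · rintro (rfl | rfl)
      · exact ⟨hx₀T, himg⟩
      · refine ⟨hx₁T, ?_⟩
        rw [← himg]
        -- exchanging `x₀` for the element `x` of the same colour does not change the colours
        ext k
        simp only [Finset.mem_image, Finset.mem_erase]
        constructor
        · rintro ⟨z, ⟨hz1, hzT⟩, rfl⟩
          by_cases hz0 : z = x₀
          · exact ⟨x, ⟨hne, hx₁T⟩, by rw [hc₁, hz0]⟩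
          · exact ⟨z, ⟨hz0, hzT⟩, rfl⟩
        · rintro ⟨z, ⟨hz1, hzT⟩, rfl⟩
          by_cases hz0 : z = x
          · exact ⟨x₀, ⟨hne.symm, hx₀T⟩, by rw [← hc₁, hz0]⟩
          · exact ⟨z, ⟨hz0, hzT⟩, rfl⟩
  rw [this, Finset.card_pair hne.symm]
  exact even_two

/-- **Scarf's lemma.** The points of `V` are ranked by each `u i` and coloured by `c`. For each `i`
there is a slack point `b i` of colour `i` that is lowest in the `i`-th ranking, and above all
ordinary points in the other rankings. Then some dominant set of `card I` points carries all
colours. The proof counts the pairs of a dominant set of `card I` points and a facet of it that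
carries exactly the colours other than `i₀`: the facet made up of the slack points lies in one
dominant set and each other one lies in two. -/
theorem exists_isDominant_image_eq_univ (hI : 1 < Fintype.card I)
    (hu : ∀ i, Function.Injective (u i)) (b : I → V)
    (hlow : ∀ i v, v ≠ b i → u i (b i) < u i v)
    (hhigh : ∀ i j, i ≠ j → ∀ v, (∀ k, v ≠ b k) → u i v < u i (b j))
    (c : V → I) (hc : ∀ i, c (b i) = i) :
    ∃ T : Finset V, IsDominant u T ∧ T.card = Fintype.card I ∧ T.image c = Finset.univ := by
  classical
  by_contra! hcon
  obtain ⟨i₀⟩ : Nonempty I := Fintype.card_pos_iff.1 (by omega)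
  have hlow' : ∀ i v, u i (b i) ≤ u i v := by
    intro i v
    rcases eq_or_ne v (b i) with rfl | h
    · exact le_rfl
    · exact (hlow i v h).le
  have hbinj : Function.Injective b := fun i j h => by rw [← hc i, h, hc]
  set rooms : Finset (Finset V) :=
    Finset.univ.filter fun T => IsDominant u T ∧ T.card = Fintype.card I with hrooms
  set doors : Finset (Finset V) :=
    Finset.univ.filter fun S => IsDominant u S ∧ S.card + 1 = Fintype.card I ∧
      S.image c = Finset.univ.erase i₀ with hdoors
  have hsum := Finset.sum_card_bipartiteAbove_eq_sum_card_bipartiteBelow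
    (s := rooms) (t := doors) (fun T S => S ⊆ T)
  have heven : Even (∑ T ∈ rooms, (doors.bipartiteAbove (fun T S => S ⊆ T) T).card) := by
    apply Finset.even_sum
    intro T hT
    obtain ⟨hTd, hTc⟩ : IsDominant u T ∧ T.card = Fintype.card I := by simpa [hrooms] using hT
    refine (congrArg (Even ∘ Finset.card) ?_).mpr
      (even_card_facets (i₀ := i₀) hTc (hcon T hTd hTc))
    ext S
    simp only [Finset.bipartiteAbove, hdoors, Finset.mem_filter, Finset.mem_univ, true_and]
    constructor
    · rintro ⟨⟨-, h1, h2⟩, h3⟩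
      exact ⟨h1, h2, h3⟩
    · rintro ⟨h1, h2, h3⟩
      exact ⟨⟨hTd.mono h3, h1, h2⟩, h3⟩
  have hbelow : ∀ S, rooms.bipartiteBelow (fun T S => S ⊆ T) S =
      Finset.univ.filter fun T : Finset V =>
        (IsDominant u T ∧ T.card = Fintype.card I) ∧ S ⊆ T := by
    intro S
    ext T
    simp [Finset.bipartiteBelow, hrooms]
  -- the exceptional door, consisting of slack points only
  set S₀ : Finset V := (Finset.univ.erase i₀).image b with hS₀
  have hS₀mem : ∀ k, k ≠ i₀ → b k ∈ S₀ := fun k hk =>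
    Finset.mem_image_of_mem _ (by simpa using hk)
  have hS₀d : IsDominant u S₀ := by
    intro y
    by_cases hy : ∃ k, y = b k
    · obtain ⟨k, rfl⟩ := hy
      exact ⟨k, fun x _ => hlow' k x⟩
    · push Not at hy
      refine ⟨i₀, fun x hx => ?_⟩
      obtain ⟨k, hk, rfl⟩ := Finset.mem_image.1 hx
      exact (hhigh i₀ k (Finset.mem_erase.1 hk).1.symm y hy).le
  have hS₀c : S₀.card + 1 = Fintype.card I := by
    rw [hS₀, Finset.card_image_of_injective _ hbinj, Finset.card_erase_of_mem (Finset.mem_univ _),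
      Finset.card_univ]
    omega
  have hS₀D : S₀ ∈ doors := by
    simp only [hdoors, Finset.mem_filter, Finset.mem_univ, true_and]
    refine ⟨hS₀d, hS₀c, ?_⟩
    rw [hS₀, Finset.image_image, show c ∘ b = id from funext hc, Finset.image_id]
  have hone : (rooms.bipartiteBelow (fun T S => S ⊆ T) S₀).card = 1 := by
    rw [hbelow]
    obtain ⟨p, hpS, hp, j₁, j₂, hj, hall, h₁, h₂, -, hX₁, hX₂⟩ := exists_extensions hu hS₀d
      (Finset.card_pos.1 (by omega)) hS₀c
    have hpb : ∀ i, i ≠ i₀ → p i = b i := fun i hi =>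
      hu i (le_antisymm (hp i _ (hS₀mem i hi)) (hlow' i _))
    have himg : (Finset.univ.erase i₀).image p = S₀ :=
      Finset.image_congr fun i hi => hpb i (by simpa using hi)
    have hi₀ne : (candidates u p i₀).Nonempty := by
      refine ⟨b i₀, ?_⟩
      simp only [candidates, Finset.mem_filter, Finset.mem_univ, true_and]
      intro i hi
      rw [hpb i hi]
      exact hlow i _ fun h => hi (hbinj h).symm
    -- one of the two droppable indices of `S₀` is `i₀`; the other one has no candidates
    have hempty : ∀ k, k ≠ i₀ → (Finset.univ.erase k).image p = S₀ →
        ¬ (candidates u p k).Nonempty := by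
      rintro k hk hkS ⟨y, hy⟩
      simp only [candidates, Finset.mem_filter, Finset.mem_univ, true_and] at hy
      have hpk : p i₀ = b k := by
        obtain ⟨i, hi, hik⟩ := Finset.mem_image.1 (hkS ▸ hS₀mem k hk)
        by_cases hii : i = i₀
        · rw [← hii, hik]
        · rw [hpb i hii] at hik
          exact absurd (hbinj hik) (Finset.mem_erase.1 hi).1
      by_cases hyb : ∃ l, y = b l
      · obtain ⟨l, rfl⟩ := hyb
        by_cases hl : l = k
        · subst hl
          exact lt_irrefl _ (hpk ▸ hy i₀ hk.symm)
        · exact absurd (hlow' l (p l)) (not_le.2 (hy l hl))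
      · push Not at hyb
        have h1 := hy i₀ hk.symm
        rw [hpk] at h1
        exact lt_asymm h1 (hhigh i₀ k hk.symm y hyb)
    rcases hall i₀ himg with h | h
    · subst h
      obtain ⟨X, hXc, hX⟩ := hX₁ hi₀ne (hempty j₂ hj.symm h₂)
      rw [card_filter_superset_eq hS₀c hX, hXc]
    · subst h
      obtain ⟨X, hXc, hX⟩ := hX₂ (hempty j₁ hj h₁) hi₀ne
      rw [card_filter_superset_eq hS₀c hX, hXc]
  have htwo : ∀ S ∈ doors.erase S₀,
      (rooms.bipartiteBelow (fun T S => S ⊆ T) S).card = 2 := by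
    intro S hS
    obtain ⟨hSne, hSD⟩ := Finset.mem_erase.1 hS
    simp only [hdoors, Finset.mem_filter, Finset.mem_univ, true_and] at hSD
    obtain ⟨hSd, hSc, hSimg⟩ := hSD
    rw [hbelow]
    obtain ⟨p, hpS, hp, j₁, j₂, hj, hall, h₁, h₂, hX, -⟩ := exists_extensions hu hSd
      (Finset.card_pos.1 (by omega)) hSc
    obtain ⟨t, htS, ht⟩ : ∃ t ∈ S, ∀ k, t ≠ b k := by
      by_contra! hall
      refine hSne (Finset.eq_of_subset_of_card_le (fun v hv => ?_) (by omega))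
      obtain ⟨k, rfl⟩ := hall v hv
      refine hS₀mem k ?_
      have h := Finset.mem_image_of_mem c hv
      rw [hSimg, hc] at h
      exact (Finset.mem_erase.1 h).1
    -- the slack point `b j` is a candidate for `j`, since it lies above the ordinary point `t`
    have hcand : ∀ j, (candidates u p j).Nonempty := by
      refine fun j => ⟨b j, ?_⟩
      simp only [candidates, Finset.mem_filter, Finset.mem_univ, true_and]
      exact fun i hi => (hp i t htS).trans_lt (hhigh i j hi t ht)
    obtain ⟨X, hXc, hX⟩ := hX (hcand j₁) (hcand j₂)
    rw [card_filter_superset_eq hSc hX, hXc]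
  rw [hsum, ← Finset.sum_erase_add _ _ hS₀D, hone, Finset.sum_congr rfl htwo] at heven
  simp [Nat.even_add_one] at heven

end Scarf

/-! ### Brouwer's fixed point theorem -/

section Brouwer

variable {I : Type*} [Fintype I] [DecidableEq I]

/-- Scarf's lemma on the grid of points of the simplex with coordinates in `ℕ / m`, here scaled by
`m`: for every colouring there is a grid point `s` such that for each `i` either `s i` is at most
`card I`, or some grid point of colour `i` differs from `s` by at most `card I` in the `i`-th
coordinate and in all the others. -/
lemma exists_grid_point (hI : 1 < Fintype.card I) (m : ℕ) (c : (I → ℕ) → I) :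
    ∃ s : I → ℕ, ∑ i, s i = m ∧ ∀ i, s i ≤ Fintype.card I ∨
      ∃ t : I → ℕ, ∑ k, t k = m ∧ c t = i ∧
        ∀ k, s k ≤ t k + Fintype.card I ∧ t k ≤ s k + Fintype.card I := by
  classical
  let G := {t : I → Fin (m + 1) // ∑ i, (t i : ℕ) = m}
  let V := G ⊕ I
  let val : G → I → ℕ := fun t i => t.1 i
  have hval : ∀ s : I → ℕ, ∑ i, s i = m → ∃ t : G, val t = s := by
    intro s hs
    have hle : ∀ i, s i < m + 1 := fun i =>
      Nat.lt_succ_of_le (hs ▸ Finset.single_le_sum (fun _ _ => Nat.zero_le _) (Finset.mem_univ i))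
    exact ⟨⟨fun i => ⟨s i, hle i⟩, hs⟩, rfl⟩
  -- The height of `v` in the `i`-th ranking; the slack points get values outside `[1, m + 1]`.
  let w : I → V → ℕ := fun i v =>
    v.elim (fun t => val t i + 1) (fun k => if k = i then 0 else m + 2)
  let e : V ≃ Fin (Fintype.card V) := Fintype.equivFin V
  -- Ties are broken by an arbitrary enumeration.
  let u : I → V → ℕ ×ₗ Fin (Fintype.card V) := fun i v => toLex (w i v, e v)
  have hult : ∀ i v v', w i v < w i v' → u i v < u i v' := fun i v v' h =>
    Prod.Lex.toLex_lt_toLex.2 (Or.inl h)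
  have hule : ∀ i v v', u i v ≤ u i v' → w i v ≤ w i v' := by
    intro i v v' h
    rcases Prod.Lex.toLex_le_toLex.1 h with h | h
    · exact le_of_lt h
    · exact h.1.le
  let col : V → I := fun v => v.elim (fun t => c (val t)) id
  obtain ⟨T, hTd, -, hTc⟩ := exists_isDominant_image_eq_univ (u := u) hI
    (fun i v v' h => e.injective (congrArg (fun z => (ofLex z).2) h)) Sum.inr
    (by
      rintro i (t | k) h
      · exact hult _ _ _ (by simp [w])
      · have : k ≠ i := fun hk => h (by rw [hk])
        exact hult _ _ _ (by simp [w, this]))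
    (by
      rintro i j hij (t | k) h
      · refine hult _ _ _ ?_
        have : val t i < m + 1 := (t.1 i).2
        simp only [w, Sum.elim_inl, Sum.elim_inr, if_neg hij.symm]
        omega
      · exact absurd rfl (h k))
    col (fun i => rfl)
  -- The indices whose slack point is absent from `T`.
  let C : Finset I := {i | (Sum.inr i : V) ∉ T}
  have hCmem : ∀ i, i ∈ C ↔ (Sum.inr i : V) ∉ T := fun i => by simp [C]
  have hcol : ∀ i ∈ C, ∃ t : G, (Sum.inl t : V) ∈ T ∧ c (val t) = i := by
    intro i hi
    have : i ∈ T.image col := hTc ▸ Finset.mem_univ i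
    obtain ⟨v, hv, hvi⟩ := Finset.mem_image.1 this
    rcases v with t | k
    · exact ⟨t, hv, hvi⟩
    · have hk : k = i := hvi
      exact absurd hv ((hCmem k).1 (hk ▸ hi))
  have hdom : ∀ t : G, ∃ i ∈ C, ∀ s : G, (Sum.inl s : V) ∈ T → val t i ≤ val s i := by
    intro t
    obtain ⟨i, hi⟩ := hTd (Sum.inl t)
    refine ⟨i, (hCmem i).2 fun hiT => ?_, fun s hs => ?_⟩
    · have := hule _ _ _ (hi _ hiT)
      simp [w] at this
    · have := hule _ _ _ (hi _ hs)
      simpa [w] using this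
  obtain ⟨i₀⟩ : Nonempty I := Fintype.card_pos_iff.1 (by omega)
  obtain ⟨t₀, -⟩ := hval (Pi.single i₀ m) (by simp)
  obtain ⟨i₁, hi₁, -⟩ := hdom t₀
  obtain ⟨s, hsT, -⟩ := hcol i₁ hi₁
  let σ : Finset G := {t | (Sum.inl t : V) ∈ T}
  have hσ : ∀ t, t ∈ σ ↔ (Sum.inl t : V) ∈ T := fun t => by simp [σ]
  choose q hqσ hq using fun i => σ.exists_min_image (fun t => val t i) ⟨s, (hσ s).2 hsT⟩
  let μ : I → ℕ := fun i => val (q i) i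
  have hμ : ∀ i, ∀ t ∈ σ, μ i ≤ val t i := hq
  -- Otherwise there would be room for a grid point strictly above `μ` on `C`.
  have hbig : m < ∑ i ∈ C, (μ i + 1) := by
    by_contra! hle
    obtain ⟨t, ht⟩ := hval (fun i => (if i ∈ C then μ i + 1 else 0) +
        if i = i₀ then m - ∑ i ∈ C, (μ i + 1) else 0) (by
      rw [Finset.sum_add_distrib, Finset.sum_ite_mem, Finset.univ_inter,
        Finset.sum_ite_eq' Finset.univ i₀, if_pos (Finset.mem_univ _)]
      omega)
    obtain ⟨i, hiC, hi⟩ := hdom t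
    have h1 := hi (q i) ((hσ _).1 (hqσ i))
    rw [ht] at h1
    simp only [if_pos hiC] at h1
    have : val (q i) i = μ i := rfl
    omega
  rw [Finset.sum_add_distrib, Finset.sum_const, smul_eq_mul, mul_one] at hbig
  have hsum : ∀ t : G, ∑ i ∈ C, val t i + ∑ i ∈ Cᶜ, val t i = m := fun t => by
    rw [Finset.sum_add_sum_compl]
    exact t.2
  have hCle : C.card ≤ Fintype.card I := Finset.card_le_univ C
  have hin : ∀ t ∈ σ, ∀ i ∈ C, val t i ≤ μ i + Fintype.card I := by
    intro t ht i hi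
    have h1 := hsum t
    have h2 := Finset.sum_erase_add C (val t) hi
    have h3 := Finset.sum_erase_add C μ hi
    have h4 : ∑ k ∈ C.erase i, μ k ≤ ∑ k ∈ C.erase i, val t k :=
      Finset.sum_le_sum fun k _ => hμ k t ht
    omega
  have hout : ∀ t ∈ σ, ∀ i, i ∉ C → val t i ≤ Fintype.card I := by
    intro t ht i hi
    have h1 := hsum t
    have h2 : val t i ≤ ∑ k ∈ Cᶜ, val t k :=
      Finset.single_le_sum (f := val t) (fun _ _ => Nat.zero_le _) (Finset.mem_compl.2 hi)
    have h4 : ∑ k ∈ C, μ k ≤ ∑ k ∈ C, val t k :=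
      Finset.sum_le_sum fun k _ => hμ k t ht
    omega
  have hclose : ∀ t ∈ σ, ∀ t' ∈ σ, ∀ k, val t k ≤ val t' k + Fintype.card I := by
    intro t ht t' ht' k
    by_cases hk : k ∈ C
    · have h1 := hin t ht k hk
      have h2 := hμ k t' ht'
      omega
    · have h1 := hout t ht k hk
      omega
  have hsσ := (hσ s).2 hsT
  refine ⟨val s, s.2, fun i => ?_⟩
  by_cases hi : i ∈ C
  · obtain ⟨t, htT, hti⟩ := hcol i hi
    have htσ := (hσ t).2 htT
    exact Or.inr ⟨val t, t.2, hti, fun k => ⟨hclose s hsσ t htσ k, hclose t htσ s hsσ k⟩⟩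
  · exact Or.inl (hout s hsσ i hi)

/-- A continuous self-map of the simplex has points that it lowers in no coordinate by more than
`ε`. -/
lemma exists_le_add_of_continuousOn_stdSimplex (hI : 1 < Fintype.card I)
    {f : (I → ℝ) → I → ℝ} (hf : ContinuousOn f (stdSimplex ℝ I))
    (hmaps : MapsTo f (stdSimplex ℝ I) (stdSimplex ℝ I)) {ε : ℝ} (hε : 0 < ε) :
    ∃ x ∈ stdSimplex ℝ I, ∀ i, x i ≤ f x i + ε := by
  classical
  have huc := (isCompact_stdSimplex ℝ I).uniformContinuousOn_of_continuous hf
  obtain ⟨δ, hδ, huc⟩ := Metric.uniformContinuousOn_iff.1 huc (ε / 2) (by positivity)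
  obtain ⟨m, hm⟩ := exists_nat_gt ((Fintype.card I : ℝ) / min δ (ε / 2))
  have hmin : 0 < min δ (ε / 2) := lt_min hδ (by positivity)
  have hm0 : (0 : ℝ) < m := lt_of_le_of_lt (by positivity) hm
  have hmesh : (Fintype.card I : ℝ) / m < min δ (ε / 2) := by
    rw [div_lt_iff₀ hmin] at hm
    rw [div_lt_iff₀ hm0]
    linarith
  let pt : (I → ℕ) → I → ℝ := fun t i => (t i : ℝ) / m
  have hpt : ∀ t : I → ℕ, ∑ i, t i = m → pt t ∈ stdSimplex ℝ I := by
    intro t ht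
    refine ⟨fun i => by positivity, ?_⟩
    rw [← Finset.sum_div, ← Nat.cast_sum, ht, div_self hm0.ne']
  have hcolour : ∀ t : I → ℕ, ∃ i, ∑ i, t i = m → pt t i ≤ f (pt t) i := by
    intro t
    obtain ⟨i₀⟩ : Nonempty I := Fintype.card_pos_iff.1 (by omega)
    by_cases ht : ∑ i, t i = m
    · by_contra! hcon
      have h1 := (hmaps (hpt t ht)).2
      have h2 := (hpt t ht).2
      have h3 : ∑ i, f (pt t) i < ∑ i, pt t i :=
        Finset.sum_lt_sum_of_nonempty ⟨i₀, Finset.mem_univ _⟩ fun i _ => (hcon i).2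
      linarith
    · exact ⟨i₀, fun h => absurd h ht⟩
  choose c hc using hcolour
  obtain ⟨s, hs, hcell⟩ := exists_grid_point hI m c
  refine ⟨pt s, hpt s hs, fun i => ?_⟩
  rcases hcell i with hi | ⟨t, ht, hti, hclose⟩
  · have h1 : pt s i ≤ (Fintype.card I : ℝ) / m := by
      simp only [pt]
      gcongr
    have h2 := (hmaps (hpt s hs)).1 i
    have h3 := min_le_right δ (ε / 2)
    linarith
  · have habs : ∀ k, |pt s k - pt t k| ≤ (Fintype.card I : ℝ) / m := by
      intro k
      have h1 : (s k : ℝ) ≤ t k + Fintype.card I := by exact_mod_cast (hclose k).1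
      have h2 : (t k : ℝ) ≤ s k + Fintype.card I := by exact_mod_cast (hclose k).2
      simp only [pt]
      rw [← sub_div, abs_div, abs_of_pos hm0]
      gcongr
      rw [abs_le]
      constructor <;> linarith
    have hdist : dist (pt s) (pt t) < δ := by
      refine (dist_pi_lt_iff hδ).2 fun k => ?_
      rw [Real.dist_eq]
      exact (habs k).trans_lt (hmesh.trans_le (min_le_left _ _))
    have h1 := (dist_le_pi_dist _ _ i).trans_lt (huc _ (hpt s hs) _ (hpt t ht) hdist)
    rw [Real.dist_eq, abs_lt] at h1
    have h2 := hc t ht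
    rw [hti] at h2
    have h3 := (abs_le.1 (habs i)).2
    have h4 := min_le_right δ (ε / 2)
    linarith [h1.1]

/-- Brouwer's fixed point theorem on the standard simplex. -/
theorem exists_fixedPoint_stdSimplex (hI : 1 < Fintype.card I)
    {f : (I → ℝ) → I → ℝ} (hf : ContinuousOn f (stdSimplex ℝ I))
    (hmaps : MapsTo f (stdSimplex ℝ I) (stdSimplex ℝ I)) :
    ∃ x ∈ stdSimplex ℝ I, f x = x := by
  classical
  obtain ⟨i₀⟩ : Nonempty I := Fintype.card_pos_iff.1 (by omega)
  have hg : ContinuousOn (fun x => ∑ i, max (x i - f x i) 0) (stdSimplex ℝ I) := by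
    refine continuousOn_finsetSum _ fun i _ => ContinuousOn.sup ?_ continuousOn_const
    exact (continuous_apply i).continuousOn.sub (continuousOn_pi.1 hf i)
  obtain ⟨x, hx, hmin⟩ := (isCompact_stdSimplex ℝ I).exists_isMinOn
    ⟨Pi.single i₀ 1, single_mem_stdSimplex ℝ i₀⟩ hg
  have hzero : ∑ i, max (x i - f x i) 0 ≤ 0 := by
    refine le_of_forall_pos_le_add fun ε hε => ?_
    have hcard : (0 : ℝ) < Fintype.card I := by exact_mod_cast (by omega : 0 < Fintype.card I)
    obtain ⟨y, hy, hyε⟩ := exists_le_add_of_continuousOn_stdSimplex hI hf hmaps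
      (div_pos hε hcard)
    calc ∑ i, max (x i - f x i) 0 ≤ ∑ i, max (y i - f y i) 0 := hmin hy
      _ ≤ ∑ _i : I, ε / Fintype.card I := by
        refine Finset.sum_le_sum fun i _ => max_le ?_ (by positivity)
        linarith [hyε i]
      _ = 0 + ε := by
        rw [Finset.sum_const, Finset.card_univ, nsmul_eq_mul, mul_div_cancel₀ _ hcard.ne', zero_add]
  have hle : ∀ i ∈ Finset.univ, x i ≤ f x i := by
    intro i hi
    have h1 := Finset.single_le_sum (f := fun i => max (x i - f x i) 0)
      (fun _ _ => le_max_right _ _) hi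
    have h2 := le_max_left (x i - f x i) 0
    linarith
  have hsum : ∑ i, x i = ∑ i, f x i := by rw [hx.2, (hmaps hx).2]
  exact ⟨x, hx, funext fun i =>
    ((Finset.sum_eq_sum_iff_of_le hle).1 hsum i (Finset.mem_univ i)).symm⟩

/-- Brouwer's fixed point theorem on a box. -/
theorem exists_fixedPoint_Icc {J : Type*} [Fintype J] [Nonempty J] {l h : J → ℝ}
    (hlh : l ≤ h) {f : (J → ℝ) → J → ℝ} (hf : ContinuousOn f (Icc l h))
    (hmaps : MapsTo f (Icc l h) (Icc l h)) : ∃ x ∈ Icc l h, f x = x := by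
  classical
  -- `L` is the size of a corner simplex that contains the translate of the box to the origin.
  obtain ⟨L, hL0, hL⟩ : ∃ L : ℝ, 0 < L ∧ ∑ j, (h j - l j) ≤ L :=
    ⟨max 1 (∑ j, (h j - l j)), lt_max_of_lt_left one_pos, le_max_right _ _⟩
  let π : (Option J → ℝ) → J → ℝ := fun z j => min (l j + L * z (some j)) (h j)
  let ι : (J → ℝ) → Option J → ℝ := fun x k =>
    k.elim (1 - ∑ j, (x j - l j) / L) (fun j => (x j - l j) / L)
  have hπ : Continuous π := by
    refine continuous_pi fun j => ?_
    exact (continuous_const.add (continuous_const.mul (continuous_apply _))).min continuous_const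
  have hι : Continuous ι := by
    refine continuous_pi fun k => ?_
    cases k with
    | none =>
      exact continuous_const.sub (continuous_finsetSum _ fun j _ =>
        ((continuous_apply j).sub continuous_const).div_const _)
    | some j => exact ((continuous_apply j).sub continuous_const).div_const _
  have hπmaps : MapsTo π (stdSimplex ℝ (Option J)) (Icc l h) := by
    refine fun z hz => ⟨fun j => le_min ?_ (hlh j), fun j => min_le_right _ _⟩
    have := mul_nonneg hL0.le (hz.1 (some j))
    linarith
  have hιmaps : MapsTo ι (Icc l h) (stdSimplex ℝ (Option J)) := by
    refine fun x hx => ⟨fun k => ?_, ?_⟩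
    · cases k with
      | none =>
        have h1 : ∑ j, (x j - l j) ≤ ∑ j, (h j - l j) :=
          Finset.sum_le_sum fun j _ => sub_le_sub_right (hx.2 j) _
        simp only [ι, Option.elim_none, ← Finset.sum_div]
        rw [sub_nonneg, div_le_one hL0]
        exact h1.trans hL
      | some j => exact div_nonneg (sub_nonneg.2 (hx.1 j)) hL0.le
    · rw [Fintype.sum_option]
      simp [ι]
  have hπι : ∀ x ∈ Icc l h, π (ι x) = x := by
    intro x hx
    funext j
    simp only [π, ι, Option.elim_some]
    rw [mul_div_cancel₀ _ hL0.ne', add_sub_cancel, min_eq_left (hx.2 j)]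
  have hcard : 1 < Fintype.card (Option J) := by
    rw [Fintype.card_option]
    have := Fintype.card_pos (α := J)
    omega
  obtain ⟨z, hz, hfz⟩ := exists_fixedPoint_stdSimplex hcard (f := fun z => ι (f (π z)))
    (hι.comp_continuousOn (hf.comp hπ.continuousOn hπmaps))
    (fun z hz => hιmaps (hmaps (hπmaps hz)))
  refine ⟨π z, hπmaps hz, ?_⟩
  have h1 := hπι _ (hmaps (hπmaps hz))
  rw [hfz] at h1
  exact h1.symm

end Brouwer

/-! ### Aggregation functions and essential bounds -/

section Deterministic

variable {N : ℕ} {F : (Fin N → ℝ) × (Fin N → ℝ) → EReal}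

lemma IsAggregation.effDom_mono (hF : IsAggregation F) {p q : (Fin N → ℝ) × (Fin N → ℝ)}
    (hp : p ∈ effDom F) (hpq : p ≤ q) : q ∈ effDom F := fun hq =>
  hp (le_bot_iff.1 (hq ▸ hF.monotone hpq))

lemma IsAggregation.coe_toReal (hF : IsAggregation F) {p : (Fin N → ℝ) × (Fin N → ℝ)}
    (hp : p ∈ effDom F) : ((F p).toReal : EReal) = F p :=
  EReal.coe_toReal (hF.ne_top p) hp

lemma IsAggregation.toReal_mono (hF : IsAggregation F) {p q : (Fin N → ℝ) × (Fin N → ℝ)}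
    (hp : p ∈ effDom F) (hpq : p ≤ q) : (F p).toReal ≤ (F q).toReal :=
  EReal.toReal_le_toReal (hF.monotone hpq) hp (hF.ne_top q)

lemma IsAggregation.continuousOn_toReal (hF : IsAggregation F) :
    ContinuousOn (fun p => (F p).toReal) (effDom F) := by
  refine EReal.continuousOn_toReal.comp hF.continuousOn fun p hp => ?_
  have := hF.ne_top p
  simp only [mem_compl_iff, mem_insert_iff, mem_singleton_iff, not_or]
  exact ⟨hp, this⟩

lemma IsAggregation.measurable_toReal (hF : IsAggregation F) :
    Measurable fun p => (F p).toReal := by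
  classical
  have h : (fun p => (F p).toReal) =
      (effDom F).piecewise (fun p => (F p).toReal) (fun _ => 0) := by
    funext p
    by_cases hp : p ∈ effDom F
    · rw [piecewise_eq_of_mem _ _ _ hp]
    · have hbot : F p = ⊥ := by simpa [effDom] using hp
      rw [piecewise_eq_of_notMem _ _ _ hp, hbot, EReal.toReal_bot]
  rw [h]
  exact hF.continuousOn_toReal.measurable_piecewise continuousOn_const hF.dom_closed.measurableSet

end Deterministic

section Random

variable {Ω : Type*} [MeasurableSpace Ω] {P : Measure Ω} {N : ℕ}

/-- An essentially bounded random vector lies almost surely in a box whose lower corner, the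
componentwise essential infimum, lies in each rectangular upper set that almost surely contains
the random vector. -/
lemma exists_essential_bounds [IsProbabilityMeasure P] (X : Lp (Fin N → ℝ) ∞ P) :
    ∃ x₀ x₁ : Fin N → ℝ, (∀ᵐ ω ∂P, X ω ∈ Icc x₀ x₁) ∧
      ∀ A, IsRectangularUpper A → (∀ᵐ ω ∂P, X ω ∈ A) → x₀ ∈ A := by
  have hbdd : ∀ᵐ ω ∂P, ‖X ω‖ ≤ ‖X‖ := by
    have h := ae_le_eLpNormEssSup (f := X) (μ := P)
    filter_upwards [h] with ω hω
    rw [Lp.norm_def, eLpNorm_exponent_top]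
    have hfin : eLpNormEssSup X P ≠ ⊤ := by
      have := Lp.eLpNorm_ne_top X
      rwa [eLpNorm_exponent_top] at this
    have := ENNReal.toReal_mono hfin hω
    simpa using this
  have hcoord : ∀ i, ∀ᵐ ω ∂P, -‖X‖ ≤ X ω i ∧ X ω i ≤ ‖X‖ := fun i => by
    filter_upwards [hbdd] with ω hω
    have h1 := (norm_le_pi_norm (X ω) i).trans hω
    rwa [Real.norm_eq_abs, abs_le] at h1
  have hge : ∀ i, IsBoundedUnder (· ≥ ·) (ae P) (fun ω => X ω i) := fun i =>
    ⟨-‖X‖, eventually_map.2 ((hcoord i).mono fun ω h => h.1)⟩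
  have hle : ∀ i, IsCoboundedUnder (· ≥ ·) (ae P) (fun ω => X ω i) := fun i =>
    IsBoundedUnder.isCoboundedUnder_ge ⟨‖X‖, eventually_map.2 ((hcoord i).mono fun ω h => h.2)⟩
  refine ⟨fun i => essInf (fun ω => X ω i) P, fun _ => ‖X‖, ?_, fun A hA hX => ?_⟩
  · filter_upwards [ae_all_iff.2 hcoord, ae_all_iff.2 fun i => ae_essInf_le (hge i)] with ω h1 h2
    exact ⟨h2, fun i => (h1 i).2⟩
  · rcases hA with rfl | ⟨B, hB, rfl⟩
    · obtain ⟨ω, hω⟩ := hX.exists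
      exact absurd hω (notMem_empty _)
    · intro i _
      rcases hB i with h | ⟨a, h⟩
      · rw [h]
        exact mem_univ _
      · rw [h, mem_Ici]
        refine le_essInf_of_ae_le a ?_ (hle i)
        filter_upwards [hX] with ω hω
        have := hω i (mem_univ i)
        rwa [h] at this

variable {F : (Fin N → ℝ) × (Fin N → ℝ) → EReal} {X : Lp (Fin N → ℝ) ∞ P} {x₀ x₁ : Fin N → ℝ}

/-- `D(X) = D(x₀)` for the componentwise essential infimum `x₀` of `X`. -/
lemma IsAggregation.capDomain_eq_capSection (hF : IsAggregation F)
    (hX : ∀ᵐ ω ∂P, X ω ∈ Icc x₀ x₁)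
    (hx₀ : ∀ A, IsRectangularUpper A → (∀ᵐ ω ∂P, X ω ∈ A) → x₀ ∈ A) :
    capDomain F X = capSection F x₀ := by
  ext m
  constructor
  · exact fun hm => hx₀ (shockSection F m) (hF.rect_shock m) hm
  · intro hm
    filter_upwards [hX] with ω hω
    exact hF.effDom_mono hm ⟨hω.1, le_rfl⟩

open Classical in
/-- The aggregate `F(X, m)` as an element of `L^∞`; it is `0` if `F(X, m)` is not essentially
bounded. -/
noncomputable def aggregate (F : (Fin N → ℝ) × (Fin N → ℝ) → EReal) (X : Lp (Fin N → ℝ) ∞ P)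
    (m : Fin N → ℝ) : Lp ℝ ∞ P :=
  if h : MemLp (fun ω => (F (X ω, m)).toReal) ∞ P then h.toLp _ else 0

lemma IsAggregation.coeFn_aggregate (hF : IsAggregation F) (hX : ∀ᵐ ω ∂P, X ω ∈ Icc x₀ x₁)
    {m : Fin N → ℝ} (hm : m ∈ capSection F x₀) :
    ∀ᵐ ω ∂P, aggregate F X m ω = (F (X ω, m)).toReal := by
  have hmem : MemLp (fun ω => (F (X ω, m)).toReal) ∞ P := by
    refine memLp_top_of_bound (C := max |(F (x₀, m)).toReal| |(F (x₁, m)).toReal|) ?_ ?_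
    · have hmeas : Measurable fun x : Fin N → ℝ => (F (x, m)).toReal :=
        hF.measurable_toReal.comp (measurable_id.prodMk measurable_const)
      exact (hmeas.comp_aemeasurable (Lp.aestronglyMeasurable X).aemeasurable).aestronglyMeasurable
    · filter_upwards [hX] with ω hω
      rw [Real.norm_eq_abs]
      exact abs_le_max_abs_abs (hF.toReal_mono hm ⟨hω.1, le_rfl⟩)
        (hF.toReal_mono (hF.effDom_mono hm ⟨hω.1, le_rfl⟩) ⟨hω.2, le_rfl⟩)
  rw [aggregate, dif_pos hmem]
  exact hmem.coeFn_toLp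

lemma IsAggregation.coe_aggregate (hF : IsAggregation F) (hX : ∀ᵐ ω ∂P, X ω ∈ Icc x₀ x₁)
    {m : Fin N → ℝ} (hm : m ∈ capSection F x₀) :
    ∀ᵐ ω ∂P, F (X ω, m) = ((aggregate F X m ω : ℝ) : EReal) := by
  filter_upwards [hX, hF.coeFn_aggregate hX hm] with ω hω h
  have hp : (X ω, m) ∈ effDom F := hF.effDom_mono hm ⟨hω.1, le_rfl⟩
  rw [h, hF.coe_toReal hp]

lemma IsAggregation.accepts_iff (hF : IsAggregation F) (hX : ∀ᵐ ω ∂P, X ω ∈ Icc x₀ x₁)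
    {m : Fin N → ℝ} (hm : m ∈ capSection F x₀) (𝒜 : Set (Lp ℝ ∞ P)) :
    Accepts 𝒜 F X m ↔ aggregate F X m ∈ 𝒜 := by
  have h := hF.coe_aggregate hX hm
  constructor
  · rintro ⟨Y, hY, hYF⟩
    have : aggregate F X m = Y := by
      apply Lp.ext
      filter_upwards [h, hYF] with ω h1 h2
      exact EReal.coe_eq_coe_iff.1 (h1 ▸ h2)
    exact this ▸ hY
  · exact fun hY => ⟨_, hY, h⟩

/-! ### Risk of the aggregate -/

variable [IsProbabilityMeasure P]

lemma IsRiskMeasure.le_add_of_ae_le {ρ : Lp ℝ ∞ P → ℝ} (hρ : IsRiskMeasure ρ) {Y Y' : Lp ℝ ∞ P}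
    {c : ℝ} (h : ∀ᵐ ω ∂P, Y ω ≤ Y' ω + c) : ρ Y' ≤ ρ Y + c := by
  have hle : Y ≤ Y' + Lp.const ∞ P c := by
    rw [← Lp.coeFn_le]
    filter_upwards [h, Lp.coeFn_add Y' (Lp.const ∞ P c), Lp.coeFn_const (p := ∞) (μ := P) c]
      with ω h1 h2 h3
    rw [h2, Pi.add_apply, h3]
    exact h1
  have := hρ.monotone _ _ hle
  rw [hρ.translative] at this
  linarith

variable {ρ : Lp ℝ ∞ P → ℝ}

/-- A strictly positive aggregate at the worst shock is strictly acceptable. -/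
lemma IsAggregation.risk_aggregate_neg (hF : IsAggregation F) (hX : ∀ᵐ ω ∂P, X ω ∈ Icc x₀ x₁)
    (hρ : IsRiskMeasure ρ) {m : Fin N → ℝ} (hm : m ∈ capSection F x₀) (hpos : 0 < F (x₀, m)) :
    ρ (aggregate F X m) < 0 := by
  have hc : 0 < (F (x₀, m)).toReal := by
    rw [← hF.coe_toReal hm] at hpos
    exact_mod_cast hpos
  have h := hρ.le_add_of_ae_le (Y := 0) (Y' := aggregate F X m) (c := -(F (x₀, m)).toReal) (by
    filter_upwards [hX, hF.coeFn_aggregate hX hm, Lp.coeFn_zero ℝ ∞ P] with ω h1 h2 h3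
    rw [h2, h3, Pi.zero_apply]
    have := hF.toReal_mono hm (q := (X ω, m)) ⟨h1.1, le_rfl⟩
    linarith)
  rw [hρ.normalized] at h
  linarith

/-- A strictly negative aggregate at the best shock is not acceptable. -/
lemma IsAggregation.risk_aggregate_pos (hF : IsAggregation F) (hX : ∀ᵐ ω ∂P, X ω ∈ Icc x₀ x₁)
    (hρ : IsRiskMeasure ρ) {m : Fin N → ℝ} (hm : m ∈ capSection F x₀) (hneg : F (x₁, m) < 0) :
    0 < ρ (aggregate F X m) := by
  obtain ⟨ω, hω⟩ := hX.exists
  have hm₁ : (x₁, m) ∈ effDom F := hF.effDom_mono hm ⟨hω.1.trans hω.2, le_rfl⟩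
  have hc : (F (x₁, m)).toReal < 0 := by
    rw [← hF.coe_toReal hm₁] at hneg
    exact_mod_cast hneg
  have h := hρ.le_add_of_ae_le (Y := aggregate F X m) (Y' := 0) (c := (F (x₁, m)).toReal) (by
    filter_upwards [hX, hF.coeFn_aggregate hX hm, Lp.coeFn_zero ℝ ∞ P] with ω h1 h2 h3
    rw [h2, h3, Pi.zero_apply, zero_add]
    exact hF.toReal_mono (hF.effDom_mono hm ⟨h1.1, le_rfl⟩) ⟨h1.2, le_rfl⟩)
  rw [hρ.normalized] at h
  linarith

lemma IsAggregation.convexOn_risk_aggregate (hF : IsAggregation F)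
    (hX : ∀ᵐ ω ∂P, X ω ∈ Icc x₀ x₁) (hρ : IsCoherent ρ) :
    ConvexOn ℝ (capSection F x₀) fun m => ρ (aggregate F X m) := by
  have hconv : Convex ℝ (capSection F x₀) := by
    intro m hm m' hm' s t hs ht hst
    have h := hF.concave.1 hm hm' hs ht hst
    have hx : s • x₀ + t • x₀ = x₀ := by rw [← add_smul, hst, one_smul]
    rw [Prod.smul_mk, Prod.smul_mk, Prod.mk_add_mk, hx] at h
    exact h
  refine ⟨hconv, fun m hm m' hm' s t hs ht hst => ?_⟩
  have hle : s • aggregate F X m + t • aggregate F X m' ≤ aggregate F X (s • m + t • m') := by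
    rw [← Lp.coeFn_le]
    filter_upwards [hX, hF.coeFn_aggregate hX hm, hF.coeFn_aggregate hX hm',
      hF.coeFn_aggregate hX (hconv hm hm' hs ht hst),
      Lp.coeFn_add (s • aggregate F X m) (t • aggregate F X m'),
      Lp.coeFn_smul s (aggregate F X m), Lp.coeFn_smul t (aggregate F X m')]
      with ω h0 h1 h2 h3 h4 h5 h6
    rw [h4, Pi.add_apply, h5, h6, Pi.smul_apply, Pi.smul_apply, h1, h2, h3]
    have h := hF.concave.2 (hF.effDom_mono hm (q := (X ω, m)) ⟨h0.1, le_rfl⟩)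
      (hF.effDom_mono hm' (q := (X ω, m')) ⟨h0.1, le_rfl⟩) hs ht hst
    have hx : s • X ω + t • X ω = X ω := by rw [← add_smul, hst, one_smul]
    simpa only [Prod.smul_mk, Prod.mk_add_mk, hx] using h
  have ht' : t = 1 - s := by linarith
  subst ht'
  exact (hρ.monotone _ _ hle).trans (hρ.convex _ _ s hs (by linarith))

/-- The risk of the aggregate is continuous in the capital vector: `F` is uniformly continuous on
the compact box of shocks and capital vectors, and risk measures are `1`-Lipschitz in the
supremum norm. -/
lemma IsAggregation.continuousOn_risk_aggregate (hF : IsAggregation F)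
    (hX : ∀ᵐ ω ∂P, X ω ∈ Icc x₀ x₁) (hρ : IsRiskMeasure ρ) {l h : Fin N → ℝ}
    (hl : l ∈ capSection F x₀) :
    ContinuousOn (fun m => ρ (aggregate F X m)) (Icc l h) := by
  have hsub : Icc x₀ x₁ ×ˢ Icc l h ⊆ effDom F := fun p hp =>
    hF.effDom_mono hl ⟨hp.1.1, hp.2.1⟩
  have hcap : ∀ m ∈ Icc l h, m ∈ capSection F x₀ := fun m hm =>
    hF.effDom_mono hl ⟨le_rfl, hm.1⟩
  have huc := (isCompact_Icc.prod isCompact_Icc).uniformContinuousOn_of_continuous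
    (hF.continuousOn_toReal.mono hsub)
  rw [Metric.uniformContinuousOn_iff] at huc
  rw [Metric.continuousOn_iff]
  intro m hm ε hε
  obtain ⟨δ, hδ, hδε⟩ := huc (ε / 2) (by positivity)
  refine ⟨δ, hδ, fun m' hm' hdist => ?_⟩
  have hclose : ∀ᵐ ω ∂P, |aggregate F X m' ω - aggregate F X m ω| < ε / 2 := by
    filter_upwards [hX, hF.coeFn_aggregate hX (hcap m hm),
      hF.coeFn_aggregate hX (hcap m' hm')] with ω h0 h1 h2
    rw [h1, h2, ← Real.dist_eq]
    refine hδε (X ω, m') ⟨h0, hm'⟩ (X ω, m) ⟨h0, hm⟩ ?_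
    rw [Prod.dist_eq, dist_self]
    exact max_lt hδ hdist
  have h1 : ρ (aggregate F X m) ≤ ρ (aggregate F X m') + ε / 2 :=
    hρ.le_add_of_ae_le (hclose.mono fun ω hω => by linarith [(abs_lt.1 hω).2])
  have h2 : ρ (aggregate F X m') ≤ ρ (aggregate F X m) + ε / 2 :=
    hρ.le_add_of_ae_le (hclose.mono fun ω hω => by linarith [(abs_lt.1 hω).1])
  rw [Real.dist_eq, abs_lt]
  constructor <;> linarith

end Random

/-! ### Existence of Nash allocations -/

section Existence

variable {N : ℕ}

lemma update_mem_univ_pi {B : Fin N → Set ℝ} {m : Fin N → ℝ} (hm : m ∈ univ.pi B) {i : Fin N}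
    {a : ℝ} (ha : a ∈ B i) : Function.update m i a ∈ univ.pi B := by
  intro j _
  rcases eq_or_ne j i with rfl | hj
  · rwa [Function.update_self]
  · rw [Function.update_of_ne hj]
    exact hm j (mem_univ j)

/-- Existence of a Nash allocation in deterministic form: `φ i m` stands for the risk that
institution `i` faces under the capital vector `m` ranging over a product of upward closed sets
`B i`. If `φ i` is convex, negative at `m i = h i`, and positive at `m i < k i`, then some `r` is
in each coordinate the least admissible value given the others. -/
lemma exists_isLeast_of_convexOn [Nonempty (Fin N)] {B : Fin N → Set ℝ}
    (hB : ∀ i, B i = univ ∨ ∃ a : ℝ, B i = Ici a) {φ : Fin N → (Fin N → ℝ) → ℝ}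
    (hcont : ∀ i, ∀ l ∈ univ.pi B, ∀ h, ContinuousOn (φ i) (Icc l h))
    (hconv : ∀ i, ConvexOn ℝ (univ.pi B) (φ i)) {k h : Fin N → ℝ} (hh : h ∈ univ.pi B)
    (hneg : ∀ i, ∀ m ∈ univ.pi B, φ i (Function.update m i (h i)) < 0)
    (hpos : ∀ i, ∀ m ∈ univ.pi B, ∀ a ∈ B i, a < k i → 0 < φ i (Function.update m i a)) :
    ∃ r : Fin N → ℝ, ∀ i, IsLeast {a : ℝ | Function.update r i a ∈ univ.pi B ∧
      φ i (Function.update r i a) ≤ 0} (r i) := by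
  have hup : ∀ i, ∀ a ∈ B i, ∀ b, a ≤ b → b ∈ B i := by
    intro i a ha b hab
    rcases hB i with hi | ⟨d, hi⟩
    · rw [hi]
      exact mem_univ b
    · rw [hi, mem_Ici] at ha ⊢
      exact ha.trans hab
  -- the lower corner of the box in which the allocation is sought
  have hlow : ∀ i, ∃ c ∈ B i, ∀ a ∈ B i, a < c → a < k i := by
    intro i
    rcases hB i with hi | ⟨d, hi⟩
    · exact ⟨k i, hi ▸ mem_univ _, fun a _ ha => ha⟩
    · refine ⟨max (k i) d, hi ▸ mem_Ici.2 (le_max_right _ _), fun a ha hlt => ?_⟩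
      rw [hi, mem_Ici] at ha
      exact (lt_max_iff.1 hlt).resolve_right (not_lt.2 ha)
  choose l hlB hl using hlow
  have hlD : l ∈ univ.pi B := fun i _ => hlB i
  have hlh : l ≤ h := by
    intro i
    by_contra hlt
    rw [not_le] at hlt
    have hhi := hh i (mem_univ i)
    exact lt_asymm (hpos i h hh (h i) hhi (hl i (h i) hhi hlt)) (hneg i h hh)
  have hbox : ∀ m ∈ Icc l h, m ∈ univ.pi B := fun m hm i _ => hup i _ (hlB i) _ (hm.1 i)
  -- each coordinate is raised by the current risk and clamped to the box
  let f : (Fin N → ℝ) → Fin N → ℝ := fun m i => max (l i) (min (h i) (m i + φ i m))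
  have hf : ContinuousOn f (Icc l h) := by
    refine continuousOn_pi.2 fun i => continuousOn_const.sup (continuousOn_const.inf ?_)
    exact (continuous_apply i).continuousOn.add (hcont i l hlD h)
  have hmaps : MapsTo f (Icc l h) (Icc l h) := fun m _ =>
    ⟨fun i => le_max_left _ _, fun i => max_le (hlh i) (min_le_left _ _)⟩
  obtain ⟨r, hr, hfr⟩ := exists_fixedPoint_Icc hlh hf hmaps
  have hrD := hbox r hr
  refine ⟨r, fun i => ?_⟩
  have hri : max (l i) (min (h i) (r i + φ i r)) = r i := congrFun hfr i
  have hhB := hh i (mem_univ i)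
  have hle : φ i r ≤ 0 := by
    by_contra! hlt
    have h1 : min (h i) (r i + φ i r) ≤ r i := (le_max_right _ _).trans hri.le
    have h2 : h i ≤ r i := (min_le_iff.1 h1).resolve_right (by linarith)
    have h3 := hneg i r hrD
    rw [le_antisymm h2 (hr.2 i), Function.update_eq_self] at h3
    linarith
  refine ⟨by simpa only [mem_ofPred_eq, Function.update_eq_self] using ⟨hrD, hle⟩, ?_⟩
  rintro a ⟨haD, ha⟩
  by_contra! hlt
  have haB : a ∈ B i := by
    have := haD i (mem_univ i)
    rwa [Function.update_self] at this
  rcases eq_or_lt_of_le (hr.1 i) with hli | hli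
  · exact absurd (hpos i r hrD a haB (hl i a haB (hli ▸ hlt))) (not_lt.2 ha)
  · have hge : r i ≤ r i + φ i r := by
      rcases max_choice (l i) (min (h i) (r i + φ i r)) with hm | hm
      · rw [hm] at hri
        exact absurd hri hli.ne
      · rw [hm] at hri
        exact hri.ge.trans (min_le_right _ _)
    -- `r` lies between the points with `i`-th coordinate `a` and `h i`, so convexity makes `φ i r`
    -- negative, while the fixed point equation says that it is nonnegative
    have hah : 0 < h i - a := by linarith [hr.2 i]
    have hcomb : ((h i - r i) / (h i - a)) • Function.update r i a +
        ((r i - a) / (h i - a)) • Function.update r i (h i) = r := by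
      funext j
      simp only [Pi.add_apply, Pi.smul_apply, smul_eq_mul]
      rcases eq_or_ne j i with rfl | hj
      · rw [Function.update_self, Function.update_self]
        field_simp
        ring
      · rw [Function.update_of_ne hj, Function.update_of_ne hj]
        field_simp
        ring
    have hs : 0 ≤ (h i - r i) / (h i - a) := div_nonneg (sub_nonneg.2 (hr.2 i)) hah.le
    have ht : 0 < (r i - a) / (h i - a) := div_pos (sub_pos.2 hlt) hah
    have hst : (h i - r i) / (h i - a) + (r i - a) / (h i - a) = 1 := by
      field_simp
      ring
    have h1 := (hconv i).2 haD (update_mem_univ_pi hrD hhB) hs ht.le hst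
    rw [hcomb, smul_eq_mul, smul_eq_mul] at h1
    have h2 := mul_nonpos_of_nonneg_of_nonpos hs ha
    have h3 := mul_neg_of_pos_of_neg ht (hneg i r hrD)
    linarith

variable {Ω : Type*} [MeasurableSpace Ω] {P : Measure Ω} [IsProbabilityMeasure P]

lemma exists_nash_allocation [Nonempty (Fin N)] {ρ : Lp ℝ ∞ P → ℝ} (hρ : IsCoherent ρ)
    {Λ : (Fin N → ℝ) × (Fin N → ℝ) → EReal} (hΛ : IsAggregation Λ)
    {Λs : Fin N → (Fin N → ℝ) × (Fin N → ℝ) → EReal} (hdec : IsDecomposition Λ Λs)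
    (X : Lp (Fin N → ℝ) ∞ P) (hX : (capDomain Λ X).Nonempty) :
    ∃ r : Fin N → ℝ, ∀ i, IsGLB {a : ℝ | Function.update r i a ∈ capDomain Λ X ∧
      Accepts (acceptanceSet ρ) (Λs i) X (Function.update r i a)} (r i) := by
  obtain ⟨x₀, x₁, hb, hx₀⟩ := exists_essential_bounds X
  rw [hΛ.capDomain_eq_capSection hb hx₀] at hX ⊢
  have hsec : ∀ i, capSection (Λs i) x₀ = capSection Λ x₀ := fun i => by
    rw [capSection, capSection, hdec.consistent_domain i]
  have hx : x₀ ≤ x₁ := by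
    obtain ⟨ω, hω⟩ := hb.exists
    exact hω.1.trans hω.2
  have hsub : capSection Λ x₀ ⊆ capSection Λ x₁ := fun m hm => hΛ.effDom_mono hm ⟨hx, le_rfl⟩
  obtain ⟨h, hh, hfeas⟩ := hdec.self_feasible x₀ hX
  obtain ⟨k, -, hinfeas⟩ := hdec.self_infeasible x₁ (hX.mono hsub)
  obtain ⟨B, hB, hD⟩ : ∃ B : Fin N → Set ℝ, (∀ i, B i = univ ∨ ∃ a : ℝ, B i = Ici a) ∧
      capSection Λ x₀ = univ.pi B :=
    (hΛ.rect_cap x₀).resolve_left hX.ne_empty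
  obtain ⟨r, hr⟩ := exists_isLeast_of_convexOn hB (φ := fun i m => ρ (aggregate (Λs i) X m))
    (fun i l hl h => (hdec.aggregation i).continuousOn_risk_aggregate hb hρ.toIsRiskMeasure
      (by rwa [hsec, hD]))
    (fun i => by
      rw [← hD, ← hsec i]
      exact (hdec.aggregation i).convexOn_risk_aggregate hb hρ)
    (k := k) (h := h) (hD ▸ hh)
    (fun i m hm => (hdec.aggregation i).risk_aggregate_neg hb hρ.toIsRiskMeasure
      (by
        rw [hsec, hD]
        exact update_mem_univ_pi hm ((hD ▸ hh : h ∈ univ.pi B) i (mem_univ i)))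
      (hfeas m (hD ▸ hm) i))
    (fun i m hm a ha hak => (hdec.aggregation i).risk_aggregate_pos hb hρ.toIsRiskMeasure
      (by
        rw [hsec, hD]
        exact update_mem_univ_pi hm ha)
      (by
        have := hinfeas m (hsub (hD ▸ hm)) i (k i - a) (sub_pos.2 hak)
        rwa [sub_sub_cancel] at this))
  refine ⟨r, fun i => ?_⟩
  have hset : {a : ℝ | Function.update r i a ∈ capSection Λ x₀ ∧
      Accepts (acceptanceSet ρ) (Λs i) X (Function.update r i a)} =
      {a : ℝ | Function.update r i a ∈ univ.pi B ∧
        ρ (aggregate (Λs i) X (Function.update r i a)) ≤ 0} := by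
    ext a
    rw [mem_ofPred_eq, mem_ofPred_eq, hD]
    refine and_congr_right fun ha => ?_
    rw [(hdec.aggregation i).accepts_iff hb (by rwa [hsec, hD])]
    rfl
  rw [hset]
  exact (hr i).isGLB

end Existence

end NashAllocation

theorem mainTheorem1 {Ω : Type*} [MeasurableSpace Ω] (P : Measure Ω) [IsProbabilityMeasure P]
    (N : ℕ) (hN : 1 ≤ N)
    (ρ : Lp ℝ ∞ P → ℝ) (hρ : IsCoherent ρ) (hcont : ContinuousFromAbove ρ)
    (Λ : (Fin N → ℝ) × (Fin N → ℝ) → EReal) (hΛ : IsAggregation Λ)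
    (Λs : Fin N → (Fin N → ℝ) × (Fin N → ℝ) → EReal) (hdec : IsDecomposition Λ Λs) :
    ∃ r : shockSpace P Λ → Fin N → ℝ,
      IsNashAllocationRule (acceptanceSet ρ) Λ Λs r := by
  have : Nonempty (Fin N) := ⟨⟨0, hN⟩⟩
  choose r hr using fun X : shockSpace P Λ => exists_nash_allocation hρ hΛ hdec X.1 X.2
  exact ⟨r, hr⟩
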